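/- Let $S$ be a finite set, $V=(v_1,\dots,v_n)\in\mathbb Z^n$, and let $f$ assign to each word in $S^n$ a probability distribution on $S$. The probabilistic cellular automaton (PCA) $F$ on $S^{\mathbb Z}$ with neighbourhood $V$ and transition function $f$ is the map $\mu\mapsto\mu F$ on the Borel probability measures of $S^{\mathbb Z}$ (with the product topology) determined on cylinders by $$\mu F\{u : u_k=y_k\ \forall k\in K\}=\sum_{x\in S^{V(K)}}\mu\{u : u_j=x_j\ \forall j\in V(K)\}\prod_{k\in K} f(x_{k+v_1},\dots,x_{k+v_n})(y_k)$$ for every finite $K\subset\mathbb Z$ and $y\in S^K$, where $V(K)=\{k+v_i : k\in K,\ 1\le i\le n\}$; that is, all sites are updated simultaneously and independently, the new letter at site $k$ having law $f(x_{k+v_1},\dots,x_{k+v_n})$ when the present configuration is $x$. A probability measure $\mu$ is invariant if $\mu F=\mu$. The PCA is ergodic if it has a unique invariant measure $\mu$ and $\nu F^m\to\mu$ weakly as $m\to\infty$ for every probability measure $\nu$ on $S^{\mathbb Z}$. Model A is the PCA $F_A$ on $\{0,1\}^{\mathbb Z}$ with neighbourhood $(-1,0)$ and transition function $a$ given by $a(00)(1)=1/2$,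 $a(01)(1)=0$, $a(10)(1)=1$, $a(11)(1)=1/2$. Let $(01)^{\mathbb Z}$ be the configuration equal to $0$ at even sites and $1$ at odd sites, and $(10)^{\mathbb Z}$ the configuration equal to $1$ at even sites and $0$ at odd sites. **Theorem.** The PCA $F_A$ has a unique invariant measure, namely $\frac12\bigl(\delta_{(01)^{\mathbb Z}}+\delta_{(10)^{\mathbb Z}}\bigr)$, and $F_A$ is not ergodic: for every $m\ge 0$, $\delta_{(01)^{\mathbb Z}}F_A^{2m}=\delta_{(01)^{\mathbb Z}}$ and $\delta_{(01)^{\mathbb Z}}F_A^{2m+1}=\delta_{(10)^{\mathbb Z}}$. Consequently, it is not true that every PCA with a unique invariant measure is ergodic. -/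

import Mathlib

open MeasureTheory Filter Topology
open scoped ENNReal

/-- A one-dimensional probabilistic cellular automaton on the alphabet `S`. The neighbourhood is
the tuple `(nbhd 0, …, nbhd (n - 1))` of integers, and the transition function assigns to each
word `u ∈ S ^ n`, read along the neighbourhood, a probability distribution on `S`. -/
structure PCA (S : Type*) (n : ℕ) where
  /-- the neighbourhood -/
  nbhd : Fin n → ℤ
  /-- the transition function -/
  trans : (Fin n → S) → PMF S

namespace PCA

variable {S : Type*} {n : ℕ}

/-- The word of the configuration `x` read along the neighbourhood of the site `k`. -/
def localWord (F : PCA S n) (x : ℤ → S) (k : ℤ) : Fin n → S := fun i => x (k + F.nbhd i)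

/-- The set `V(K)` of the sites on which the update of the sites in `K` depends. -/
def domain (F : PCA S n) (K : Finset ℤ) : Finset ℤ :=
  (K ×ˢ Finset.univ).image fun p : ℤ × Fin n => p.1 + F.nbhd p.2

theorem mem_domain (F : PCA S n) (K : Finset ℤ) (k : K) (i : Fin n) :
    (k : ℤ) + F.nbhd i ∈ F.domain K :=
  Finset.mem_image.2 ⟨((k : ℤ), i), by simp, rfl⟩

/-- The cylinder of the configurations that agree with `y` on `K`. -/
def cylinder {K : Finset ℤ} (y : K → S) : Set (ℤ → S) := {u | ∀ k : K, u k = y k}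

variable [Finite S] [MeasurableSpace S] [MeasurableSingletonClass S]

/-- The law of the configuration at the next time when the present configuration is `x`: all the
sites are updated independently, the site `k` with law `F.trans (F.localWord x k)`. -/
noncomputable def updateLaw (F : PCA S n) (x : ℤ → S) : Measure (ℤ → S) :=
  Measure.infinitePi fun k => (F.trans (F.localWord x k)).toMeasure

instance (F : PCA S n) (x : ℤ → S) : IsProbabilityMeasure (F.updateLaw x) := by
  unfold updateLaw; infer_instance

theorem measurable_updateLaw (F : PCA S n) : Measurable F.updateLaw := by
  refine Measurable.measure_of_isPiSystem_of_isProbabilityMeasure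
    (generateFrom_squareCylinders (α := fun _ : ℤ => S)).symm
    (isPiSystem_squareCylinders (C := fun _ : ℤ => {s : Set S | MeasurableSet s})
      (fun _ => MeasurableSpace.isPiSystem_measurableSet) (fun _ => MeasurableSet.univ)) ?_
  rintro _ ⟨K, t, ht, rfl⟩
  have key : ∀ x : ℤ → S, F.updateLaw x ((K : Set ℤ).pi t)
      = ∏ k ∈ K, (F.trans (F.localWord x k)).toMeasure (t k) := fun x =>
    Measure.infinitePi_pi _ (fun k _ => ht k (Set.mem_univ _))
  simp only [key]
  refine Finset.measurable_prod _ fun k _ => ?_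
  have h1 : Measurable fun w : Fin n → S => (F.trans w).toMeasure (t k) := measurable_of_finite _
  have h2 : Measurable fun x : ℤ → S => F.localWord x k :=
    measurable_pi_lambda _ fun i => measurable_pi_apply (k + F.nbhd i)
  exact h1.comp h2

/-- The action `μ ↦ μ F` of the PCA on the probability measures on `S ^ ℤ`. -/
noncomputable def step (F : PCA S n) (μ : ProbabilityMeasure (ℤ → S)) :
    ProbabilityMeasure (ℤ → S) :=
  ⟨(μ : Measure (ℤ → S)).bind F.updateLaw,
    isProbabilityMeasure_bind F.measurable_updateLaw.aemeasurable
      (Eventually.of_forall fun _ => inferInstance)⟩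

/-- The defining formula of a PCA: the value of `μ F` on the cylinders. -/
theorem step_cylinder [Fintype S] (F : PCA S n) (μ : ProbabilityMeasure (ℤ → S)) (K : Finset ℤ)
    (y : K → S) :
    (F.step μ : Measure (ℤ → S)) (cylinder y) =
      ∑ x : F.domain K → S, (μ : Measure (ℤ → S)) (cylinder x) *
        ∏ k : K, F.trans (fun i => x ⟨(k : ℤ) + F.nbhd i, F.mem_domain K k i⟩) (y k) := by
  classical
  have hmeas : ∀ (L : Finset ℤ) (z : L → S), MeasurableSet (cylinder z) := by
    intro L z
    have : cylinder z = ⋂ k : L, (fun u : ℤ → S => u k) ⁻¹' {z k} := by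
      ext u; simp [cylinder]
    rw [this]
    exact MeasurableSet.iInter fun k => measurable_pi_apply _ (measurableSet_singleton _)
  have hupd : ∀ u : ℤ → S, F.updateLaw u (cylinder y)
      = ∏ k : K, F.trans (F.localWord u k) (y k) := by
    intro u
    have hc : cylinder y = (K : Set ℤ).pi
        (fun k => if h : k ∈ K then {y ⟨k, h⟩} else Set.univ) := by
      ext v
      simp only [cylinder, Set.mem_ofPred_eq, Set.mem_pi, Finset.mem_coe, Subtype.forall]
      refine forall_congr' fun k => forall_congr' fun hk => ?_
      simp [hk]
    rw [hc, updateLaw, Measure.infinitePi_pi _ (fun k hk => by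
      split_ifs <;> simp), ← Finset.prod_coe_sort]
    refine Finset.prod_congr rfl fun k _ => ?_
    simp
  have hstep : (F.step μ : Measure (ℤ → S)) (cylinder y)
      = ∫⁻ u, F.updateLaw u (cylinder y) ∂(μ : Measure (ℤ → S)) :=
    Measure.bind_apply (hmeas K y) F.measurable_updateLaw.aemeasurable
  have hsum : ∀ u : ℤ → S, F.updateLaw u (cylinder y) = ∑ x : F.domain K → S,
      (cylinder x).indicator (fun _ => ∏ k : K,
        F.trans (fun i => x ⟨(k : ℤ) + F.nbhd i, F.mem_domain K k i⟩) (y k)) u := by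
    intro u
    rw [hupd, Finset.sum_eq_single (fun j : F.domain K => u j)]
    · rw [Set.indicator_of_mem (by simp [cylinder])]
      rfl
    · intro x _ hx
      refine Set.indicator_of_notMem (fun hu => hx (funext fun j => (hu j).symm)) _
    · intro h; exact absurd (Finset.mem_univ _) h
  rw [hstep]
  simp only [hsum]
  rw [lintegral_finsetSum _ fun x _ => measurable_const.indicator (hmeas _ x)]
  refine Finset.sum_congr rfl fun x _ => ?_
  rw [lintegral_indicator_const (hmeas _ x), mul_comm]

/-- `μ` is an invariant measure of `F`: `μ F = μ`. -/
def IsInvariant (F : PCA S n) (μ : ProbabilityMeasure (ℤ → S)) : Prop :=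
  F.step μ = μ

/-- `F` is ergodic: it has a unique invariant measure, which is attractive, i.e. `ν F ^ m`
converges weakly to it for every initial probability measure `ν`. -/
def IsErgodic [TopologicalSpace S] [DiscreteTopology S] (F : PCA S n) : Prop :=
  ∃ μ : ProbabilityMeasure (ℤ → S),
    (F.IsInvariant μ ∧ ∀ μ' : ProbabilityMeasure (ℤ → S), F.IsInvariant μ' → μ' = μ) ∧
    ∀ ν : ProbabilityMeasure (ℤ → S), Tendsto (fun m : ℕ => F.step^[m] ν) atTop (𝓝 μ)

end PCA

/-- The probability distribution on `{0, 1}` that gives mass `p` to `1`. -/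
noncomputable def coin (p : ℝ≥0∞) (hp : p ≤ 1) : PMF (Fin 2) :=
  PMF.ofFintype ![1 - p, p] (by simp [Fin.sum_univ_two, tsub_add_cancel_of_le hp])

/-- The probability that Model A puts a `1` at a site where it reads the word `u`. -/
noncomputable def modelAProb (u : Fin 2 → Fin 2) : ℝ≥0∞ :=
  if u = ![0, 0] then 1 / 2
  else if u = ![0, 1] then 0
  else if u = ![1, 0] then 1
  else 1 / 2

theorem modelAProb_le_one (u : Fin 2 → Fin 2) : modelAProb u ≤ 1 := by
  unfold modelAProb
  split_ifs <;> simp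

/-- Model A: the PCA on `{0, 1} ^ ℤ` with neighbourhood `(-1, 0)` and transition function
`a(00)(1) = 1/2`, `a(01)(1) = 0`, `a(10)(1) = 1`, `a(11)(1) = 1/2`. -/
noncomputable def modelA : PCA (Fin 2) 2 where
  nbhd := ![-1, 0]
  trans := fun u => coin (modelAProb u) (modelAProb_le_one u)

theorem modelA_trans :
    modelA.trans ![0, 0] 1 = 1 / 2 ∧ modelA.trans ![0, 1] 1 = 0 ∧
      modelA.trans ![1, 0] 1 = 1 ∧ modelA.trans ![1, 1] 1 = 1 / 2 := by
  simp [modelA, coin, modelAProb]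

/-- The configuration `(01)^ℤ`: `0` at even sites and `1` at odd sites. -/
def config01 : ℤ → Fin 2 := fun k => if Even k then 0 else 1

/-- The configuration `(10)^ℤ`: `1` at even sites and `0` at odd sites. -/
def config10 : ℤ → Fin 2 := fun k => if Even k then 1 else 0

/-- The Dirac measure at a configuration, as a probability measure. -/
noncomputable def diracConfig (x : ℤ → Fin 2) : ProbabilityMeasure (ℤ → Fin 2) :=
  ⟨Measure.dirac x, inferInstance⟩

/-- The probability measure `(δ_{(01)^ℤ} + δ_{(10)^ℤ}) / 2`. -/
noncomputable def alternatingMeasure : ProbabilityMeasure (ℤ → Fin 2) :=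
  ⟨(1 / 2 : ℝ≥0∞) • (Measure.dirac config01 + Measure.dirac config10),
    ⟨by simp [ENNReal.inv_two_add_inv_two]⟩⟩

/-!
Write `z k = x k + k` modulo `2`. A cell of Model A takes the letter of its left neighbour or the
opposite of its own letter, each with probability `1 / 2` (`modelA_trans_apply`). Up to a global
flip at each time step, this says that the voter at `k` copies the opinion `z` of the voter at
`k - 1` or keeps its own: Model A is a voter model in disguise, and its consensus states are the
two configurations `(01)^ℤ` and `(10)^ℤ`, which the flip exchanges.

Let `μ` be invariant and `D j k` the probability that the voters at `j` and `k` disagree. For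
`j ≠ k` the two voters choose whom to copy independently, so `D j k` is the mean of `D` over the
four pairs of sources (`four_mul_disagreement_le` is the inequality needed here). Hence
`M d = sup_j D j (j + d)` satisfies `2 * M (d + 1) ≤ M (d + 2) + M d`. A bounded convex sequence is
nonincreasing, and `M 0 = 0`, so `M = 0` (`nonpos_of_four_mul_le`): `μ` is carried by the
two consensus states. One step exchanges them, so invariance forces equal weights, while the orbit
of a Dirac measure at one of them has period two and does not converge.
-/

/-! ### Model A as a voter model -/

/-- A cell of Model A takes the letter of its left neighbour or the opposite of its own letter,
with probability `1 / 2` each. -/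
theorem modelA_trans_apply (u : Fin 2 → Fin 2) (b : Fin 2) :
    modelA.trans u b =
      2⁻¹ * ((if u 0 = b then 1 else 0) + (if u 1 = b then 0 else 1)) := by
  obtain ⟨p, q, rfl⟩ : ∃ p q, u = ![p, q] := ⟨u 0, u 1, by ext i; fin_cases i <;> rfl⟩
  fin_cases p <;> fin_cases q <;> fin_cases b <;>
    simp [modelA, coin, modelAProb, one_add_one_eq_two, ENNReal.inv_mul_cancel,
      ENNReal.one_sub_inv_two]

@[simp] theorem modelA_localWord (x : ℤ → Fin 2) (k : ℤ) :
    modelA.localWord x k = ![x (k - 1), x k] := by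
  ext i
  fin_cases i <;> simp [PCA.localWord, modelA, sub_eq_add_neg]

theorem PCA.updateLaw_pair {S : Type*} {n : ℕ} [Finite S] [MeasurableSpace S]
    [MeasurableSingletonClass S] (F : PCA S n) (x : ℤ → S) {j k : ℤ} (hjk : j ≠ k) (a b : S) :
    F.updateLaw x {y | y j = a ∧ y k = b} =
      F.trans (F.localWord x j) a * F.trans (F.localWord x k) b := by
  have hset : {y : ℤ → S | y j = a ∧ y k = b} =
      (({j, k} : Finset ℤ) : Set ℤ).pi fun i => {if i = j then a else b} := by
    ext y
    simp [hjk.symm]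
  rw [hset, PCA.updateLaw, Measure.infinitePi_pi _ fun _ _ => measurableSet_singleton _,
    Finset.prod_pair hjk]
  simp [hjk.symm, PMF.toMeasure_apply_singleton]

/-- The configurations in which the voters at the sites `j` and `k` disagree, the opinion of the
voter at `i` being `x i + i` modulo `2`. -/
def disagreement (j k : ℤ) : Set (ℤ → Fin 2) := {x | ¬ (x j = x k ↔ Even (k - j))}

theorem measurableSet_disagreement (j k : ℤ) : MeasurableSet (disagreement j k) := by
  unfold disagreement
  measurability

@[simp] theorem disagreement_self (j : ℤ) : disagreement j j = ∅ := by
  simp [disagreement]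

/-- Two distinct voters disagree after one step exactly when the two voters they independently
copied did; each of the four pairs of sources has probability `1 / 4`. -/
theorem four_mul_updateLaw_disagreement_le (x : ℤ → Fin 2) {j k : ℤ} (hjk : j ≠ k) :
    4 * modelA.updateLaw x (disagreement j k) ≤
      (disagreement j k).indicator 1 x + (disagreement (j - 1) k).indicator 1 x +
        (disagreement j (k - 1)).indicator 1 x +
        (disagreement (j - 1) (k - 1)).indicator 1 x := by
  have h4 : (4 : ℝ≥0∞) * (2⁻¹ * 2⁻¹) = 1 := by
    rw [← ENNReal.mul_inv (by simp) (by simp), show (2 : ℝ≥0∞) * 2 = 4 by norm_num]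
    exact ENNReal.mul_inv_cancel (by simp) (by simp)
  have hmul : ∀ p q r s : ℝ≥0∞, 4 * (2⁻¹ * p * (2⁻¹ * q) + 2⁻¹ * r * (2⁻¹ * s)) =
      p * q + r * s := by
    intro p q r s
    calc _ = 4 * (2⁻¹ * 2⁻¹) * (p * q + r * s) := by ring
      _ = _ := by rw [h4, one_mul]
  have e1 : Even (k - (j - 1)) ↔ ¬ Even (k - j) := by
    rw [show k - (j - 1) = k - j + 1 by ring, Int.even_add_one]
  have e2 : Even (k - 1 - j) ↔ ¬ Even (k - j) := by
    rw [show k - 1 - j = k - j - 1 by ring, Int.even_sub_one]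
  have e3 : Even (k - 1 - (j - 1)) ↔ Even (k - j) := by
    rw [show k - 1 - (j - 1) = k - j by ring]
  -- given the parity of `k - j`, disagreement is the union of two events `y j = a ∧ y k = b`
  obtain ⟨b, hb⟩ : ∃ b : Fin 2 → Fin 2, b = fun a => if Even (k - j) then 1 - a else a := ⟨_, rfl⟩
  have hsub : disagreement j k ⊆
      {y | y j = 0 ∧ y k = b 0} ∪ {y | y j = 1 ∧ y k = b 1} := by
    intro y hy
    simp only [disagreement, Set.mem_ofPred_eq, Set.mem_union, hb] at hy ⊢
    generalize y j = p at *
    generalize y k = q at *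
    by_cases h : Even (k - j) <;> fin_cases p <;> fin_cases q <;> simp_all
  refine (mul_le_mul_right ((measure_mono hsub).trans (measure_union_le _ _)) 4).trans ?_
  rw [PCA.updateLaw_pair _ _ hjk, PCA.updateLaw_pair _ _ hjk]
  simp only [modelA_localWord, modelA_trans_apply, hmul, disagreement, Set.indicator_apply,
    Set.mem_ofPred_eq, e1, e2, e3, hb, Pi.one_apply, Matrix.cons_val_zero, Matrix.cons_val_one]
  generalize x (j - 1) = p
  generalize x j = q
  generalize x (k - 1) = r
  generalize x k = s
  by_cases h : Even (k - j) <;> fin_cases p <;> fin_cases q <;> fin_cases r <;> fin_cases s <;>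
    norm_num [h]

/-! ### Disagreement under an invariant measure -/

theorem PCA.step_apply {S : Type*} {n : ℕ} [Finite S] [MeasurableSpace S]
    [MeasurableSingletonClass S] (F : PCA S n) (μ : ProbabilityMeasure (ℤ → S))
    {A : Set (ℤ → S)} (hA : MeasurableSet A) :
    (F.step μ : Measure (ℤ → S)) A = ∫⁻ x, F.updateLaw x A ∂(μ : Measure (ℤ → S)) :=
  Measure.bind_apply hA F.measurable_updateLaw.aemeasurable

theorem four_mul_disagreement_le {μ : ProbabilityMeasure (ℤ → Fin 2)}
    (hμ : modelA.IsInvariant μ) {j k : ℤ} (hjk : j ≠ k) :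
    4 * (μ : Measure (ℤ → Fin 2)).real (disagreement j k) ≤
      (μ : Measure (ℤ → Fin 2)).real (disagreement j k) +
        (μ : Measure (ℤ → Fin 2)).real (disagreement (j - 1) k) +
        (μ : Measure (ℤ → Fin 2)).real (disagreement j (k - 1)) +
        (μ : Measure (ℤ → Fin 2)).real (disagreement (j - 1) (k - 1)) := by
  have hm : ∀ i l, Measurable ((disagreement i l).indicator (1 : (ℤ → Fin 2) → ℝ≥0∞)) :=
    fun i l => measurable_one.indicator (measurableSet_disagreement i l)
  have h : 4 * (μ : Measure (ℤ → Fin 2)) (disagreement j k) ≤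
      (μ : Measure (ℤ → Fin 2)) (disagreement j k) +
        (μ : Measure (ℤ → Fin 2)) (disagreement (j - 1) k) +
        (μ : Measure (ℤ → Fin 2)) (disagreement j (k - 1)) +
        (μ : Measure (ℤ → Fin 2)) (disagreement (j - 1) (k - 1)) := by
    calc 4 * (μ : Measure (ℤ → Fin 2)) (disagreement j k)
        = 4 * (modelA.step μ : Measure (ℤ → Fin 2)) (disagreement j k) := by
          rw [show modelA.step μ = μ from hμ]
      _ = ∫⁻ x, 4 * modelA.updateLaw x (disagreement j k) ∂(μ : Measure (ℤ → Fin 2)) := by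
          rw [PCA.step_apply _ _ (measurableSet_disagreement j k),
            lintegral_const_mul' _ _ (by simp)]
      _ ≤ _ := lintegral_mono fun x => four_mul_updateLaw_disagreement_le x hjk
      _ = _ := by
          rw [lintegral_add_right _ (hm _ _), lintegral_add_right _ (hm _ _),
            lintegral_add_right _ (hm _ _)]
          simp only [lintegral_indicator_one (measurableSet_disagreement _ _)]
  have h' := ENNReal.toReal_mono (by simp) h
  simpa [Measure.real, ENNReal.toReal_add] using h'

/-- A bounded sequence that is midpoint convex cannot increase. -/
theorem le_apply_zero_of_bounded_of_two_mul_le {M : ℕ → ℝ} {C : ℝ} (hC : ∀ d, M d ≤ C)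
    (hM : ∀ d, 2 * M (d + 1) ≤ M (d + 2) + M d) (d : ℕ) : M d ≤ M 0 := by
  have hanti : ∀ d, M (d + 1) ≤ M d := by
    intro d
    by_contra! hd
    have hinc : ∀ e, M (d + 1) - M d ≤ M (d + e + 1) - M (d + e) := by
      intro e
      induction e with
      | zero => simp
      | succ e ih =>
        have := hM (d + e)
        rw [show d + (e + 1) + 1 = d + e + 2 by ring, show d + (e + 1) = d + e + 1 by ring]
        linarith
    have hlin : ∀ e : ℕ, M d + e * (M (d + 1) - M d) ≤ M (d + e) := by
      intro e
      induction e with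
      | zero => simp
      | succ e ih =>
        have := hinc e
        rw [← add_assoc]
        push_cast
        linarith
    obtain ⟨e, he⟩ := exists_nat_gt ((C - M d) / (M (d + 1) - M d))
    rw [div_lt_iff₀ (by linarith)] at he
    linarith [hlin e, hC (d + e)]
  exact antitone_nat_of_succ_le hanti d.zero_le

/-- If a bounded function `D`, vanishing on the diagonal, is off the diagonal at most its mean
over the four pairs of sources, then the supremum of `D j (j + d)` over `j` is a bounded convex
function of `d` that vanishes at `d = 0`, so `D` is nonpositive above the diagonal. -/
theorem nonpos_of_four_mul_le {D : ℤ → ℤ → ℝ} {C : ℝ} (hself : ∀ j, D j j = 0)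
    (hC : ∀ j k, D j k ≤ C)
    (hD : ∀ j k, j ≠ k →
      4 * D j k ≤ D j k + D (j - 1) k + D j (k - 1) + D (j - 1) (k - 1))
    (j : ℤ) (d : ℕ) : D j (j + d) ≤ 0 := by
  obtain ⟨M, hM⟩ : ∃ M : ℕ → ℝ, ∀ d, M d = ⨆ i : ℤ, D i (i + d) := ⟨_, fun _ => rfl⟩
  have hle : ∀ (d : ℕ) (i l : ℤ), l = i + d → D i l ≤ M d := by
    rintro d i _ rfl
    rw [hM]
    exact le_ciSup (f := fun i : ℤ => D i (i + d)) ⟨C, by rintro _ ⟨i, rfl⟩; exact hC _ _⟩ i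
  have hconv : ∀ d, 2 * M (d + 1) ≤ M (d + 2) + M d := by
    intro d
    suffices h : M (d + 1) ≤ (2 * M (d + 1) + M (d + 2) + M d) / 4 by linarith
    conv_lhs => rw [hM]
    refine ciSup_le fun i => ?_
    obtain ⟨k, hk⟩ : ∃ k : ℤ, k = i + ((d + 1 : ℕ) : ℤ) := ⟨_, rfl⟩
    rw [← hk]
    have h := hD i k (by omega)
    have h1 := hle (d + 1) i k hk
    have h2 := hle (d + 2) (i - 1) k (by omega)
    have h3 := hle d i (k - 1) (by omega)
    have h4 := hle (d + 1) (i - 1) (k - 1) (by omega)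
    linarith
  have hM0 : M 0 = 0 := by simp [hM, hself]
  have hMC : ∀ d, M d ≤ C := fun d => by
    rw [hM]
    exact ciSup_le fun i => hC _ _
  exact ((hle d j _ rfl).trans (le_apply_zero_of_bounded_of_two_mul_le hMC hconv d)).trans_eq hM0

/-- Under an invariant measure all voters agree almost surely. -/
theorem measure_disagreement_eq_zero {μ : ProbabilityMeasure (ℤ → Fin 2)}
    (hμ : modelA.IsInvariant μ) (j : ℤ) (d : ℕ) :
    (μ : Measure (ℤ → Fin 2)) (disagreement j (j + d)) = 0 := by
  have h := nonpos_of_four_mul_le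
    (D := fun i l => (μ : Measure (ℤ → Fin 2)).real (disagreement i l)) (C := 1)
    (fun i => by simp) (fun i l => measureReal_le_one)
    (fun i l hil => four_mul_disagreement_le hμ hil) j d
  exact (measureReal_eq_zero_iff (by simp)).1 (le_antisymm h measureReal_nonneg)

/-! ### The consensus states -/

theorem eq_config_of_forall_ne {x : ℤ → Fin 2} (hx : ∀ k, x k ≠ x (k + 1)) :
    x = config01 ∨ x = config10 := by
  have hflip : ∀ k, x (k + 1) = 1 - x k := by
    intro k
    have := hx k
    generalize x (k + 1) = p at *
    generalize x k = q at *
    fin_cases p <;> fin_cases q <;> simp_all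
  have hpar : ∀ k, x k = if Even k then x 0 else 1 - x 0 := by
    intro k
    induction k using Int.induction_on with
    | zero => simp
    | succ i ih =>
      rw [hflip, ih]
      by_cases h : Even (i : ℤ) <;> simp only [Int.even_add_one, h, not_true_eq_false,
        not_false_eq_true, if_true, if_false, sub_sub_cancel]
    | pred i ih =>
      have h1 := hflip (-(i : ℤ) - 1)
      rw [sub_add_cancel, ih] at h1
      have h2 : x (-(i : ℤ) - 1) = 1 - if Even (-(i : ℤ)) then x 0 else 1 - x 0 := by
        rw [h1]; abel
      rw [h2]
      by_cases h : Even (i : ℤ) <;> simp only [Int.even_sub_one, even_neg, h, not_true_eq_false,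
        not_false_eq_true, if_true, if_false, sub_sub_cancel]
  have h01 : x 0 = 0 ∨ x 0 = 1 := by
    generalize x 0 = p
    fin_cases p <;> simp
  refine h01.imp (fun h => ?_) fun h => ?_ <;> ext k <;> rw [hpar k, h] <;>
    simp [config01, config10]

theorem config01_ne_config10 : config01 ≠ config10 := fun h => by
  simpa [config01, config10] using congrFun h 0

/-- A configuration without two equal adjacent letters is updated deterministically: every cell
takes the letter of its left neighbour. -/
theorem updateLaw_eq_dirac {x y : ℤ → Fin 2} (hx : ∀ k, x (k - 1) ≠ x k)
    (hy : ∀ k, y k = x (k - 1)) : modelA.updateLaw x = Measure.dirac y := by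
  rw [PCA.updateLaw, ← Measure.infinitePi_dirac]
  congr 1
  ext1 k
  rw [← PMF.toMeasure_pure]
  congr 1
  ext b
  have h := hx k
  rw [modelA_trans_apply, modelA_localWord, PMF.pure_apply, hy k]
  simp only [Matrix.cons_val_zero, Matrix.cons_val_one]
  generalize x (k - 1) = p at *
  generalize x k = q at *
  fin_cases p <;> fin_cases q <;> fin_cases b <;>
    simp_all [one_add_one_eq_two, ENNReal.inv_mul_cancel]

theorem updateLaw_config01 : modelA.updateLaw config01 = Measure.dirac config10 := by
  refine updateLaw_eq_dirac (fun k => ?_) fun k => ?_ <;>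
    by_cases h : Even k <;> simp [config01, config10, h]

theorem updateLaw_config10 : modelA.updateLaw config10 = Measure.dirac config01 := by
  refine updateLaw_eq_dirac (fun k => ?_) fun k => ?_ <;>
    by_cases h : Even k <;> simp [config01, config10, h]

theorem step_diracConfig_config01 : modelA.step (diracConfig config01) = diracConfig config10 :=
  Subtype.ext ((Measure.dirac_bind modelA.measurable_updateLaw _).trans updateLaw_config01)

theorem step_diracConfig_config10 : modelA.step (diracConfig config10) = diracConfig config01 :=
  Subtype.ext ((Measure.dirac_bind modelA.measurable_updateLaw _).trans updateLaw_config10)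

theorem iterate_step_diracConfig (m : ℕ) :
    modelA.step^[2 * m] (diracConfig config01) = diracConfig config01 ∧
      modelA.step^[2 * m + 1] (diracConfig config01) = diracConfig config10 := by
  have h : modelA.step^[2 * m] (diracConfig config01) = diracConfig config01 := by
    rw [Function.iterate_mul]
    refine Function.iterate_fixed ?_ m
    simp [step_diracConfig_config01, step_diracConfig_config10]
  exact ⟨h, by rw [Function.iterate_succ_apply', h, step_diracConfig_config01]⟩

/-- One step of Model A exchanges the two Dirac measures, hence the two weights of any
combination of them. -/
theorem bind_updateLaw_combination (a b : ℝ≥0∞) :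
    (a • Measure.dirac config01 + b • Measure.dirac config10).bind modelA.updateLaw =
      a • Measure.dirac config10 + b • Measure.dirac config01 := by
  ext A hA
  rw [Measure.bind_apply hA modelA.measurable_updateLaw.aemeasurable, lintegral_add_measure,
    lintegral_smul_measure, lintegral_smul_measure, lintegral_dirac, lintegral_dirac,
    updateLaw_config01, updateLaw_config10]
  rfl

/-! ### Invariant measures and ergodicity of Model A -/

theorem alternatingMeasure_isInvariant : modelA.IsInvariant alternatingMeasure := by
  refine Subtype.ext ?_
  change Measure.bind ((1 / 2 : ℝ≥0∞) • (Measure.dirac config01 + Measure.dirac config10)) _ =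
    (1 / 2 : ℝ≥0∞) • (Measure.dirac config01 + Measure.dirac config10)
  rw [smul_add, bind_updateLaw_combination, add_comm]

theorem eq_alternatingMeasure {μ : ProbabilityMeasure (ℤ → Fin 2)}
    (hμ : modelA.IsInvariant μ) : μ = alternatingMeasure := by
  have hae : ∀ᵐ x ∂(μ : Measure (ℤ → Fin 2)), x ∈ ({config01} ∪ {config10} : Set (ℤ → Fin 2)) := by
    have h : ∀ᵐ x ∂(μ : Measure (ℤ → Fin 2)), ∀ k : ℤ, x ∉ disagreement k (k + (1 : ℕ)) :=
      ae_all_iff.2 fun k => measure_eq_zero_iff_ae_notMem.1 (measure_disagreement_eq_zero hμ k 1)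
    filter_upwards [h] with x hx
    exact eq_config_of_forall_ne fun k => by simpa [disagreement] using hx k
  obtain ⟨a, b, hab⟩ : ∃ a b : ℝ≥0∞, (μ : Measure (ℤ → Fin 2)) =
      a • Measure.dirac config01 + b • Measure.dirac config10 := by
    refine ⟨(μ : Measure (ℤ → Fin 2)) {config01}, (μ : Measure (ℤ → Fin 2)) {config10}, ?_⟩
    rw [← Measure.restrict_singleton, ← Measure.restrict_singleton, ← Measure.restrict_union
      (by simpa using config01_ne_config10) (measurableSet_singleton _),
      Measure.restrict_eq_self_of_ae_mem hae]
  have hstep : (μ : Measure (ℤ → Fin 2)) =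
      a • Measure.dirac config10 + b • Measure.dirac config01 := by
    rw [← bind_updateLaw_combination, ← hab]
    exact (congrArg Subtype.val hμ).symm
  have hba : b = a := by
    have h := congrArg (fun ν : Measure (ℤ → Fin 2) => ν {config01}) (hab.symm.trans hstep)
    simpa [config01_ne_config10, config01_ne_config10.symm] using h.symm
  have hsum : a + a = 1 := by
    have h : (μ : Measure (ℤ → Fin 2)) Set.univ = 1 := measure_univ
    simpa [hab, hba] using h
  have ha : a = 1 / 2 := by
    rw [ENNReal.eq_div_iff (by simp) (by simp), two_mul, hsum]
  refine Subtype.ext ?_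
  change (μ : Measure (ℤ → Fin 2)) =
    (1 / 2 : ℝ≥0∞) • (Measure.dirac config01 + Measure.dirac config10)
  rw [hab, hba, ha, smul_add]

theorem modelA_not_isErgodic : ¬ modelA.IsErgodic := by
  rintro ⟨μ, -, hμ⟩
  have h := hμ (diracConfig config01)
  have heven : Tendsto (fun m : ℕ => 2 * m) atTop atTop :=
    tendsto_id.const_mul_atTop' two_pos
  have h0 := h.comp heven
  have h1 := h.comp ((tendsto_add_atTop_nat 1).comp heven)
  have e0 : diracConfig config01 = μ := tendsto_nhds_unique
    (tendsto_const_nhds.congr fun m => (iterate_step_diracConfig m).1.symm) h0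
  have e1 : diracConfig config10 = μ := tendsto_nhds_unique
    (tendsto_const_nhds.congr fun m => (iterate_step_diracConfig m).2.symm) h1
  have he : Measure.dirac config01 = Measure.dirac config10 :=
    congrArg Subtype.val (e0.trans e1.symm)
  exact config01_ne_config10 (dirac_eq_dirac_iff.1 he)

theorem theorem1 :
    -- the measure `(δ_{(01)^ℤ} + δ_{(10)^ℤ}) / 2` is the unique invariant measure of Model A
    (modelA.IsInvariant alternatingMeasure ∧
      ∀ μ : ProbabilityMeasure (ℤ → Fin 2), modelA.IsInvariant μ → μ = alternatingMeasure) ∧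
    -- Model A is not ergodic
    ¬ modelA.IsErgodic ∧
    -- started from `δ_{(01)^ℤ}`, it alternates between the two Dirac measures
    (∀ m : ℕ, modelA.step^[2 * m] (diracConfig config01) = diracConfig config01 ∧
      modelA.step^[2 * m + 1] (diracConfig config01) = diracConfig config10) ∧
    -- hence uniqueness of the invariant measure of a PCA does not imply ergodicity
    ¬ (∀ (S : Type) [Finite S] [TopologicalSpace S] [DiscreteTopology S] [MeasurableSpace S]
        [MeasurableSingletonClass S] (n : ℕ) (F : PCA S n),
        (∃! μ : ProbabilityMeasure (ℤ → S), F.IsInvariant μ) → F.IsErgodic) := by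
  exact ⟨⟨alternatingMeasure_isInvariant, fun _ => eq_alternatingMeasure⟩, modelA_not_isErgodic,
    iterate_step_diracConfig, fun h => modelA_not_isErgodic (h (Fin 2) 2 modelA
      ⟨alternatingMeasure, alternatingMeasure_isInvariant, fun _ => eq_alternatingMeasure⟩)⟩
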